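/- **Theorem (Graph independence).** Let $K$ be a field of characteristic $0$ and let $(A,\epsilon)$ be a finite-dimensional, unital, associative, commutative Frobenius algebra over $K$: $\epsilon:A\to K$ is linear, and $\epsilon(ux)=0$ for all $x\in A$ implies $u=0$. Let $\eta(u,v)=\epsilon(uv)$, let $\lambda:A\to A^*$, $\langle\lambda(u),v\rangle=\eta(u,v)$, let $\delta:A\to A\otimes A$ be the comultiplication determined by $(\lambda\otimes\lambda)\circ\delta=m^*\circ\lambda$, where $m$ is the multiplication of $A$, and let $\mathbf e=m(\delta(\mathbf 1))$ be the Euler element. A *cell graph* is the $1$-skeleton of a cell decomposition of a closed oriented surface, with vertices labelled bijectively by a finite totally ordered set (usually $\{1,\dots,n\}$), up to label- and orientation-preserving homeomorphism. It is of type $(g,n)$ if the surface is connected of genus $g$ and there are $n$ vertices; $\Gamma_{g,n}$ is the set of these connected cell graphs. *ECO 1* contracts an edge from $p_i$ to $p_j$, $i\ne j$, to one vertex labelled $i$. *ECO 2* contracts a loop at $p_i$ and breaks $p_i$ into two vertices, $i_1$ (to the left of the directed loop, carrying the half-edges strictly between its outgoing and its incoming end in counterclockwise order) and $i_2$ (to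 its right, carrying the other half-edges); the result $\gamma'$ is connected (loop of handle) or a disjoint union of two connected cell graphs (separating loop). Let $\omega$ be an ECO functor, with value $\omega_A$ at $(A,\epsilon)$: to every (possibly disconnected) cell graph $\gamma$ with $n$ vertices there is assigned a linear map $\omega_A(\gamma):A^{\otimes n}\to K$, depending only on the isomorphism class of $\gamma$, such that * $\omega_A(\bullet)=\epsilon$ for the graph $\bullet$ with one vertex and no edges; * $\omega_A$ is monoidal: $\omega_A(\gamma_1\sqcup\gamma_2)=\omega_A(\gamma_1)\otimes\omega_A(\gamma_2)$ (the factors being matched by their labels), and $\omega_A(\emptyset)=1$; * edge-contraction operations $\gamma\to\gamma'$ on connected cell graphs go to morphisms of objects over $K$: $\omega_A(\gamma)=\omega_A(\gamma')\circ m_{ij}$ for ECO 1, where $m_{ij}:A^{\otimes n}\to A^{\otimes(n-1)}$ puts $v_iv_j$ in the factor $i$ and drops the factor $j$, and $\omega_A(\gamma)=\omega_A(\gamma')\circ\delta_i$ for ECO 2, where $\delta_i:A^{\otimes n}\to A^{\otimes(n+1)}$ applies $\delta$ to the $i$-th factor, with values in the factors $i_1,i_2$. Then for all $g\ge 0$,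 $n\ge 1$, every connected cell graph $\gamma\in\Gamma_{g,n}$ gives the same map, namely $$\omega_A(\gamma)(v_1\otimes\cdots\otimes v_n)=\epsilon(v_1\cdots v_n\,\mathbf e^{g})\qquad\text{for all }v_1,\dots,v_n\in A .$$ -/

import Mathlib

open scoped TensorProduct BigOperators

/-! ### Commutative Frobenius algebras -/

/-- A Frobenius structure on a commutative `K`-algebra `A`: a counit `ε : A → K` such that
`ε (u * x) = 0` for all `x` implies `u = 0`. (Finite-dimensionality is a separate instance.) -/
structure FrobeniusStructure (K : Type*) (A : Type*) [Field K] [CommRing A] [Algebra K A] where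
  /-- the counit -/
  counit : A →ₗ[K] K
  nondegenerate : ∀ u : A, (∀ x : A, counit (u * x) = 0) → u = 0

namespace FrobeniusStructure

variable {K A : Type*} [Field K] [CommRing A] [Algebra K A]

/-- The Frobenius form `η(u, v) = ε(u v)`. -/
def form (F : FrobeniusStructure K A) : LinearMap.BilinForm K A :=
  (LinearMap.mul K A).compr₂ F.counit

theorem form_apply (F : FrobeniusStructure K A) (u v : A) : F.form u v = F.counit (u * v) := rfl

theorem form_nondegenerate (F : FrobeniusStructure K A) : F.form.Nondegenerate := by
  constructor
  · intro u hu
    exact F.nondegenerate u hu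
  · intro u hu
    refine F.nondegenerate u fun x => ?_
    rw [mul_comm]
    exact hu x

variable [FiniteDimensional K A]

/-- The isomorphism `λ : A ≃ A*`, `⟨λ(u), v⟩ = η(u, v)`. -/
noncomputable def toDual (F : FrobeniusStructure K A) : A ≃ₗ[K] Module.Dual K A :=
  F.form.toDual F.form_nondegenerate

/-- The comultiplication `δ : A → A ⊗ A`, defined by `(λ ⊗ λ) ∘ δ = m* ∘ λ`, where
`m* : A* → (A ⊗ A)* = A* ⊗ A*` is dual to the multiplication. (Since `A` is commutative,
the order in which `A* ⊗ A*` is paired with `A ⊗ A` is immaterial.) -/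
noncomputable def comul (F : FrobeniusStructure K A) : A →ₗ[K] A ⊗[K] A :=
  (TensorProduct.congr F.toDual F.toDual).symm.toLinearMap ∘ₗ
    (TensorProduct.dualDistribEquiv K A A).symm.toLinearMap ∘ₗ
      Module.Dual.transpose (LinearMap.mul' K A) ∘ₗ F.toDual.toLinearMap

/-- The Euler element `e = m(δ(1))`. -/
noncomputable def euler (F : FrobeniusStructure K A) : A :=
  LinearMap.mul' K A (F.comul 1)

end FrobeniusStructure

/-! ### Cell graphs -/

/-- A cell graph with vertices labelled by `V` (possibly disconnected), given as a rotation system: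
a finite set of half-edges, the permutation `rot` sending a half-edge to the next one in the
counterclockwise order around its vertex, and the fixed-point-free involution `flip` exchanging
the two half-edges of an edge. The half-edges at one vertex form one cycle of `rot`; a vertex
outside the range of `vertex` has no half-edge, and is then a connected component by itself.
A half-edge `h` is also the directed edge from `vertex h` to `vertex (flip h)`. -/
structure CellGraph (V : Type) where
  HalfEdge : Type
  finite : Finite HalfEdge
  rot : Equiv.Perm HalfEdge
  flip : Equiv.Perm HalfEdge
  flip_flip : ∀ h, flip (flip h) = h
  flip_ne : ∀ h, flip h ≠ h
  vertex : HalfEdge → V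
  vertex_eq_iff : ∀ h k, vertex h = vertex k ↔ rot.SameCycle h k

namespace CellGraph

variable {V : Type}

/-- The underlying simple graph on the set of vertices. -/
def toSimpleGraph (γ : CellGraph V) : SimpleGraph V where
  Adj p q := p ≠ q ∧ ∃ h, γ.vertex h = p ∧ γ.vertex (γ.flip h) = q
  symm := ⟨by
    rintro p q ⟨hpq, h, hp, hq⟩
    exact ⟨hpq.symm, γ.flip h, hq, by rw [γ.flip_flip]; exact hp⟩⟩
  loopless := ⟨fun p h => h.1 rfl⟩

/-- A cell graph is connected if it has a vertex and any two vertices are joined by a path. -/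
def Connected (γ : CellGraph V) : Prop := γ.toSimpleGraph.Connected

/-- The edges: orbits of `flip`. -/
def Edge (γ : CellGraph V) : Type := Quotient (Equiv.Perm.SameCycle.setoid γ.flip)

/-- The faces: orbits of the permutation `h ↦ rot (flip h)`, each a boundary of a 2-cell, together
with one face (the complement in a sphere) for each vertex without half-edges. -/
def Face (γ : CellGraph V) : Type :=
  Quotient (Equiv.Perm.SameCycle.setoid (γ.rot * γ.flip)) ⊕ {p : V // p ∉ Set.range γ.vertex}

/-- The Euler characteristic of the surface carrying `γ`. -/
noncomputable def eulerChar (γ : CellGraph V) : ℤ :=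
  (Nat.card V : ℤ) - Nat.card γ.Edge + Nat.card γ.Face

/-- `γ` is a connected cell graph of type `(g, n)`: it is connected, has `n` vertices, and
is drawn on a closed oriented surface of genus `g`. -/
def HasType (γ : CellGraph V) (g n : ℕ) : Prop :=
  γ.Connected ∧ Nat.card V = n ∧ γ.eulerChar = 2 - 2 * (g : ℤ)

/-- Isomorphisms of cell graphs: orientation preserving homeomorphisms up to isotopy, respecting
the labels (two totally ordered sets of labels being compared by the order isomorphism). -/
structure Iso {V W : Type} [LinearOrder V] [LinearOrder W]
    (γ : CellGraph V) (γ' : CellGraph W) where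
  label : V ≃o W
  halfEdge : γ.HalfEdge ≃ γ'.HalfEdge
  rot_comm : ∀ h, halfEdge (γ.rot h) = γ'.rot (halfEdge h)
  flip_comm : ∀ h, halfEdge (γ.flip h) = γ'.flip (halfEdge h)
  vertex_comm : ∀ h, label (γ.vertex h) = γ'.vertex (halfEdge h)

/-- The cell graph with vertex set `V` and no edges. -/
def edgeless (V : Type) : CellGraph V where
  HalfEdge := Empty
  finite := inferInstance
  rot := 1
  flip := 1
  flip_flip h := h.elim
  flip_ne h := h.elim
  vertex h := h.elim
  vertex_eq_iff h := h.elim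

theorem vertex_rot (γ : CellGraph V) (h : γ.HalfEdge) : γ.vertex (γ.rot h) = γ.vertex h :=
  (γ.vertex_eq_iff _ _).2 (Equiv.Perm.sameCycle_apply_left.2 (Equiv.Perm.SameCycle.refl _ _))

/-- `S` is a union of connected components of `γ`: no edge joins `S` to its complement. -/
def IsUnionOfComponents (γ : CellGraph V) (S : Set V) : Prop :=
  ∀ h, γ.vertex (γ.flip h) ∈ S ↔ γ.vertex h ∈ S

theorem IsUnionOfComponents.compl {γ : CellGraph V} {S : Set V} (hS : γ.IsUnionOfComponents S) :
    γ.IsUnionOfComponents Sᶜ := fun h => not_congr (hS h)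

/-- The part of `γ` lying over a union `S` of connected components. Thus `γ` is the disjoint union
of `γ.restrict S` and `γ.restrict Sᶜ`. -/
def restrict (γ : CellGraph V) (S : Set V) (hS : γ.IsUnionOfComponents S) : CellGraph S where
  HalfEdge := {h : γ.HalfEdge // γ.vertex h ∈ S}
  finite := haveI := γ.finite; inferInstance
  rot := γ.rot.subtypePerm fun h => by rw [γ.vertex_rot]
  flip := γ.flip.subtypePerm hS
  flip_flip h := Subtype.ext (γ.flip_flip h)
  flip_ne h e := γ.flip_ne h (congrArg Subtype.val e)
  vertex h := ⟨γ.vertex h, h.2⟩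
  vertex_eq_iff h k := by
    rw [Equiv.Perm.sameCycle_subtypePerm, ← γ.vertex_eq_iff, Subtype.mk.injEq]

/-! ### Edge-contraction operations -/

section Permutations

variable {α : Type} [DecidableEq α]

/-- The permutation obtained from `σ` by deleting `a` from its cycle (and fixing `a`):
the predecessor of `a` is sent to the successor of `a`. -/
def skip (σ : Equiv.Perm α) (a : α) : Equiv.Perm α := Equiv.swap a (σ a) * σ

theorem skip_self (σ : Equiv.Perm α) (a : α) : skip σ a a = a := by
  simp [skip]

theorem skip_of_fixed (σ : Equiv.Perm α) {a b : α} (hb : σ b = b) (hab : b ≠ a) :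
    skip σ a b = b := by
  have h : b ≠ σ a := fun h => hab (σ.injective (hb.trans h))
  simp [skip, hb, Equiv.swap_apply_of_ne_of_ne hab h]

theorem sameCycle_swap_mul (σ : Equiv.Perm α) (a b : α) {x y : α} (h : σ.SameCycle x y) :
    (Equiv.swap a b * σ).SameCycle x y ∨
      (((Equiv.swap a b * σ).SameCycle a x ∨ (Equiv.swap a b * σ).SameCycle b x) ∧
        ((Equiv.swap a b * σ).SameCycle a y ∨ (Equiv.swap a b * σ).SameCycle b y)) := by
  set τ := Equiv.swap a b * σ with hτ
  have step : ∀ z, τ.SameCycle z (σ z) ∨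
      ((τ.SameCycle a z ∨ τ.SameCycle b z) ∧ (τ.SameCycle a (σ z) ∨ τ.SameCycle b (σ z))) := by
    intro z
    have hz : τ.SameCycle (τ z) z := Equiv.Perm.sameCycle_apply_left.2 (Equiv.Perm.SameCycle.refl _ _)
    by_cases h1 : σ z = a
    · right
      have e : τ z = b := by simp [hτ, h1]
      rw [e] at hz
      exact ⟨Or.inr hz, Or.inl (by rw [h1])⟩
    · by_cases h2 : σ z = b
      · right
        have e : τ z = a := by simp [hτ, h2]
        rw [e] at hz
        exact ⟨Or.inl hz, Or.inr (by rw [h2])⟩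
      · left
        have e : τ z = σ z := by simp [hτ, Equiv.swap_apply_of_ne_of_ne h1 h2]
        rw [e] at hz
        exact hz.symm
  let R : Setoid α :=
    { r := fun x y => τ.SameCycle x y ∨
        ((τ.SameCycle a x ∨ τ.SameCycle b x) ∧ (τ.SameCycle a y ∨ τ.SameCycle b y))
      iseqv :=
        { refl := fun x => Or.inl (Equiv.Perm.SameCycle.refl _ _)
          symm := fun {x y} h => h.imp (fun h => h.symm) (fun h => h.symm)
          trans := by
            intro x y z hxy hyz
            rcases hxy with hxy | ⟨hx, hy⟩
            · rcases hyz with hyz | ⟨hy, hz⟩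
              · exact Or.inl (hxy.trans hyz)
              · exact Or.inr ⟨hy.imp (fun h => h.trans hxy.symm) (fun h => h.trans hxy.symm), hz⟩
            · rcases hyz with hyz | ⟨_, hz⟩
              · exact Or.inr ⟨hx, hy.imp (fun h => h.trans hyz) (fun h => h.trans hyz)⟩
              · exact Or.inr ⟨hx, hz⟩ } }
  have stepR : ∀ z, R z (σ z) := step
  have key : ∀ (n : ℕ) z, R z ((σ ^ n) z) := by
    intro n
    induction n with
    | zero => intro z; exact R.refl z
    | succ n ih =>
      intro z
      rw [pow_succ', Equiv.Perm.mul_apply]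
      exact R.trans (ih z) (stepR _)
  obtain ⟨n, rfl⟩ := h
  change R x ((σ ^ n) x)
  rcases n with n | n
  · simpa using key n x
  · have h := key (n + 1) ((σ ^ (Int.negSucc n)) x)
    rw [zpow_negSucc, ← Equiv.Perm.mul_apply, mul_inv_cancel, Equiv.Perm.one_apply] at h
    rw [zpow_negSucc]
    exact R.symm h

theorem swap_mul_swap_mul (σ : Equiv.Perm α) (a b : α) :
    Equiv.swap a b * (Equiv.swap a b * σ) = σ := by
  rw [← mul_assoc, Equiv.swap_mul_self, one_mul]

theorem sameCycle_of_swap_mul (σ : Equiv.Perm α) {a b : α} (hab : σ.SameCycle a b) {x y : α}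
    (h : (Equiv.swap a b * σ).SameCycle x y) : σ.SameCycle x y := by
  have := sameCycle_swap_mul (Equiv.swap a b * σ) a b h
  rw [swap_mul_swap_mul] at this
  rcases this with h | ⟨hx, hy⟩
  · exact h
  · have hx : σ.SameCycle a x := hx.elim id (fun h => hab.trans h)
    have hy : σ.SameCycle a y := hy.elim id (fun h => hab.trans h)
    exact hx.symm.trans hy

theorem sameCycle_skip (σ : Equiv.Perm α) {a x y : α} (hx : x ≠ a) (hy : y ≠ a) :
    (skip σ a).SameCycle x y ↔ σ.SameCycle x y := by
  have fix : ∀ z, z ≠ a → ¬ (skip σ a).SameCycle a z := fun z hz h =>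
    hz (h.eq_of_left (skip_self σ a)).symm
  constructor
  · exact sameCycle_of_swap_mul σ (Equiv.Perm.sameCycle_apply_right.2 (Equiv.Perm.SameCycle.refl _ _))
  · intro h
    rcases sameCycle_swap_mul σ a (σ a) h with h | ⟨h1, h2⟩
    · exact h
    · exact (h1.resolve_left (fix x hx)).symm.trans (h2.resolve_left (fix y hy))

theorem sameCycle_swap_mul_of_not (σ : Equiv.Perm α) [Finite α] {a b : α}
    (hab : ¬ σ.SameCycle a b) : (Equiv.swap a b * σ).SameCycle a b := by
  set τ := Equiv.swap a b * σ with hτ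
  have key : ∀ n : ℕ, τ.SameCycle a ((σ ^ n) a) := by
    intro n
    induction n with
    | zero => exact Equiv.Perm.SameCycle.refl _ _
    | succ n ih =>
      rw [pow_succ', Equiv.Perm.mul_apply]
      by_cases h1 : σ ((σ ^ n) a) = a
      · rw [h1]
      · have h2 : σ ((σ ^ n) a) ≠ b := fun h => hab ⟨(n + 1 : ℕ), by
          rw [zpow_natCast, pow_succ', Equiv.Perm.mul_apply, h]⟩
        have e : τ ((σ ^ n) a) = σ ((σ ^ n) a) := by
          simp only [hτ, Equiv.Perm.mul_apply, Equiv.swap_apply_of_ne_of_ne h1 h2]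
        rw [← e]
        exact Equiv.Perm.sameCycle_apply_right.2 ih
  have h : σ.SameCycle a (σ.symm a) :=
    Equiv.Perm.sameCycle_symm_apply_right.2 (Equiv.Perm.SameCycle.refl _ _)
  obtain ⟨n, hn⟩ := h.exists_nat_pow_eq
  have h' := key n
  rw [hn] at h'
  have e : τ (σ.symm a) = b := by simp [hτ]
  rw [← e]
  exact Equiv.Perm.sameCycle_apply_right.2 h'

end Permutations

open scoped Classical in
/-- The cyclic orders right after the edge of the half-edge `h` has been shrunk, with `h` and
`flip h` still present: if `h` and `flip h` lie in distinct cycles `(h a₁ … aₖ)` and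
`(flip h b₁ … bₗ)` of `rot`, these are merged to `(h a₁ … aₖ flip h b₁ … bₗ)`, and if they lie in one
cycle `(h a₁ … aₖ flip h b₁ … bₗ)`, this is broken into `(h a₁ … aₖ)` and `(flip h b₁ … bₗ)`. -/
noncomputable def shrinkRot (γ : CellGraph V) (h : γ.HalfEdge) : Equiv.Perm γ.HalfEdge :=
  Equiv.swap h (γ.flip h) * γ.rot

/-- The half-edges that remain after the edge of `h` has been contracted. -/
abbrev Remaining (γ : CellGraph V) (h : γ.HalfEdge) : Type :=
  {x : γ.HalfEdge // x ≠ h ∧ x ≠ γ.flip h}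

open scoped Classical in
theorem skip_skip_mem (γ : CellGraph V) (h x : γ.HalfEdge) :
    (skip (skip (γ.shrinkRot h) h) (γ.flip h) x ≠ h ∧
      skip (skip (γ.shrinkRot h) h) (γ.flip h) x ≠ γ.flip h) ↔ (x ≠ h ∧ x ≠ γ.flip h) := by
  have h1 : skip (skip (γ.shrinkRot h) h) (γ.flip h) h = h :=
    skip_of_fixed _ (skip_self _ _) (γ.flip_ne h).symm
  have h2 : skip (skip (γ.shrinkRot h) h) (γ.flip h) (γ.flip h) = γ.flip h := skip_self _ _
  set ρ := skip (skip (γ.shrinkRot h) h) (γ.flip h)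
  constructor
  · rintro ⟨a, b⟩
    exact ⟨fun e => a (by rw [e, h1]), fun e => b (by rw [e, h2])⟩
  · rintro ⟨a, b⟩
    exact ⟨fun e => a (ρ.injective (e.trans h1.symm)), fun e => b (ρ.injective (e.trans h2.symm))⟩

open scoped Classical in
/-- The cyclic orders after the edge of `h` has been contracted. -/
noncomputable def contractRot (γ : CellGraph V) (h : γ.HalfEdge) : Equiv.Perm (γ.Remaining h) :=
  (skip (skip (γ.shrinkRot h) h) (γ.flip h)).subtypePerm (γ.skip_skip_mem h)

open scoped Classical in
theorem sameCycle_contractRot (γ : CellGraph V) (h : γ.HalfEdge) (x y : γ.Remaining h) :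
    (γ.contractRot h).SameCycle x y ↔ (γ.shrinkRot h).SameCycle x y := by
  rw [contractRot, Equiv.Perm.sameCycle_subtypePerm, sameCycle_skip _ x.2.2 y.2.2,
    sameCycle_skip _ x.2.1 y.2.1]

/-- The remaining edges. -/
def contractFlip (γ : CellGraph V) (h : γ.HalfEdge) : Equiv.Perm (γ.Remaining h) :=
  γ.flip.subtypePerm fun x => by
    constructor
    · rintro ⟨a, b⟩
      exact ⟨fun e => b (by rw [e]), fun e => a (by rw [e, γ.flip_flip])⟩
    · rintro ⟨a, b⟩
      exact ⟨fun e => b (by rw [← e, γ.flip_flip]), fun e => a (γ.flip.injective e)⟩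

open scoped Classical in
/-- **ECO 1.** The contraction of a directed edge `h` from `pᵢ = vertex h` to a different vertex
`pⱼ = vertex (flip h)`. The label `j` is dropped, and the new vertex has the label `i`. -/
noncomputable def contractEdge (γ : CellGraph V) (h : γ.HalfEdge)
    (hne : γ.vertex h ≠ γ.vertex (γ.flip h)) : CellGraph {p : V // p ≠ γ.vertex (γ.flip h)} where
  HalfEdge := γ.Remaining h
  finite := haveI := γ.finite; inferInstance
  rot := γ.contractRot h
  flip := γ.contractFlip h
  flip_flip x := Subtype.ext (γ.flip_flip x)
  flip_ne x e := γ.flip_ne x (congrArg Subtype.val e)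
  vertex x := if hx : γ.vertex x = γ.vertex (γ.flip h) then ⟨γ.vertex h, hne⟩ else ⟨γ.vertex x, hx⟩
  vertex_eq_iff x y := by
    have := γ.finite
    rw [sameCycle_contractRot]
    have hn : ¬ γ.rot.SameCycle h (γ.flip h) := fun e => hne ((γ.vertex_eq_iff _ _).2 e)
    have hs : (γ.shrinkRot h).SameCycle h (γ.flip h) := sameCycle_swap_mul_of_not γ.rot hn
    have h1 : ∀ {x y}, γ.vertex x = γ.vertex y → (γ.shrinkRot h).SameCycle x y := by
      intro x y e
      rcases sameCycle_swap_mul γ.rot h (γ.flip h) ((γ.vertex_eq_iff _ _).1 e) with e | ⟨e1, e2⟩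
      · exact e
      · have e1 := e1.elim id (fun e => hs.trans e)
        have e2 := e2.elim id (fun e => hs.trans e)
        exact e1.symm.trans e2
    have h2 : ∀ {x y}, (γ.shrinkRot h).SameCycle x y → γ.vertex x = γ.vertex y ∨
        ((γ.vertex h = γ.vertex x ∨ γ.vertex (γ.flip h) = γ.vertex x) ∧
          (γ.vertex h = γ.vertex y ∨ γ.vertex (γ.flip h) = γ.vertex y)) := by
      intro x y e
      have := sameCycle_swap_mul (γ.shrinkRot h) h (γ.flip h) e
      rw [shrinkRot, swap_mul_swap_mul] at this
      simpa only [γ.vertex_eq_iff] using this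
    constructor
    · intro e
      by_cases hx : γ.vertex x = γ.vertex (γ.flip h) <;>
        by_cases hy : γ.vertex y = γ.vertex (γ.flip h) <;>
        simp only [hx, hy, dif_pos, dif_neg, not_false_eq_true, Subtype.mk.injEq] at e
      · exact h1 (hx.trans hy.symm)
      · exact (h1 hx).trans (hs.symm.trans (h1 e))
      · exact (h1 e).trans (hs.trans (h1 hy.symm))
      · exact h1 e
    · intro e
      have := h2 e
      by_cases hx : γ.vertex x = γ.vertex (γ.flip h) <;>
        by_cases hy : γ.vertex y = γ.vertex (γ.flip h) <;>
        simp only [hx, hy, dif_pos, dif_neg, not_false_eq_true, Subtype.mk.injEq] <;> grind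

/-- The labels after the vertex `i` has been broken into two: `i` is replaced in the totally ordered
set `V` by two consecutive elements `i₁ = (i, false) < i₂ = (i, true)`, and every other label `p` is
kept as `(p, false)`. -/
abbrev SplitLabel (V : Type) (i : V) : Type :=
  {p : V ×ₗ Bool // (ofLex p).2 = true → (ofLex p).1 = i}

instance finite_lexBool (V : Type) [Finite V] : Finite (V ×ₗ Bool) :=
  Finite.of_equiv (V × Bool) toLex

open scoped Classical in
/-- **ECO 2.** The contraction of a directed loop `h` at `pᵢ = vertex h`. The vertex `pᵢ` is broken
into two vertices: the half-edges strictly between `h` and `flip h` in the counterclockwise order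
(to the left of the outgoing half-edge `h`) are incident to `i₁`, and those strictly between
`flip h` and `h` are incident to `i₂`. The resulting cell graph may be disconnected. -/
noncomputable def contractLoop (γ : CellGraph V) (h : γ.HalfEdge)
    (hloop : γ.vertex (γ.flip h) = γ.vertex h) : CellGraph (SplitLabel V (γ.vertex h)) where
  HalfEdge := γ.Remaining h
  finite := haveI := γ.finite; inferInstance
  rot := γ.contractRot h
  flip := γ.contractFlip h
  flip_flip x := Subtype.ext (γ.flip_flip x)
  flip_ne x e := γ.flip_ne x (congrArg Subtype.val e)
  vertex x :=
    if hx : γ.vertex x = γ.vertex h ∧ ¬ (γ.shrinkRot h).SameCycle h x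
    then ⟨toLex (γ.vertex x, true), fun _ => hx.1⟩
    else ⟨toLex (γ.vertex x, false), fun e => absurd e Bool.false_ne_true⟩
  vertex_eq_iff x y := by
    rw [sameCycle_contractRot]
    have hs : γ.rot.SameCycle h (γ.flip h) := (γ.vertex_eq_iff _ _).1 hloop.symm
    have h1 : ∀ {x y}, (γ.shrinkRot h).SameCycle x y → γ.vertex x = γ.vertex y := by
      intro x y e
      exact (γ.vertex_eq_iff _ _).2 (sameCycle_of_swap_mul γ.rot hs e)
    have h2 : ∀ {x y}, γ.vertex x = γ.vertex y → (γ.shrinkRot h).SameCycle x y ∨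
        (((γ.shrinkRot h).SameCycle h x ∨ (γ.shrinkRot h).SameCycle (γ.flip h) x) ∧
          ((γ.shrinkRot h).SameCycle h y ∨ (γ.shrinkRot h).SameCycle (γ.flip h) y)) := by
      intro x y e
      exact sameCycle_swap_mul γ.rot h (γ.flip h) ((γ.vertex_eq_iff _ _).1 e)
    constructor
    · intro e
      by_cases hx : γ.vertex x = γ.vertex h ∧ ¬ (γ.shrinkRot h).SameCycle h x <;>
        by_cases hy : γ.vertex y = γ.vertex h ∧ ¬ (γ.shrinkRot h).SameCycle h y
      · rcases h2 (hx.1.trans hy.1.symm) with e | ⟨e1, e2⟩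
        · exact e
        · exact (e1.resolve_left hx.2).symm.trans (e2.resolve_left hy.2)
      · rw [dif_pos hx, dif_neg hy] at e
        exact absurd (congrArg (fun p => (ofLex p.1).2) e) (Ne.symm Bool.false_ne_true)
      · rw [dif_neg hx, dif_pos hy] at e
        exact absurd (congrArg (fun p => (ofLex p.1).2) e) Bool.false_ne_true
      · simp only [dif_neg hx, dif_neg hy, Subtype.mk.injEq, toLex_inj, Prod.mk.injEq,
          and_true] at e
        rcases h2 e with e' | ⟨e1, e2⟩
        · exact e'
        · have ex : γ.vertex x = γ.vertex h := by
            rcases e1 with e1 | e1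
            · exact (h1 e1).symm
            · exact (h1 e1).symm.trans hloop
          have hx' : (γ.shrinkRot h).SameCycle h x := by
            by_contra hc
            exact hx ⟨ex, hc⟩
          have hy' : (γ.shrinkRot h).SameCycle h y := by
            by_contra hc
            exact hy ⟨e.symm.trans ex, hc⟩
          exact hx'.symm.trans hy'
    · intro e
      have ev := h1 e
      have ec : (γ.shrinkRot h).SameCycle h x ↔ (γ.shrinkRot h).SameCycle h y :=
        ⟨fun a => a.trans e, fun a => a.trans e.symm⟩
      simp only [ev, ec]

end CellGraph

/-! ### ECO functors -/

section ECO

variable {K A : Type*} [Field K] [CommRing A] [Algebra K A]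

open scoped Classical in
/-- The vector `(v₁, …, vᵢ vⱼ, …, v̂ⱼ, …, vₙ)`: the label `j` is dropped, and the label `i`
carries `vᵢ vⱼ`. -/
noncomputable def mergeVector {V : Type} (v : V → A) (i j : V) : {p : V // p ≠ j} → A :=
  fun p => if p.1 = i then v i * v j else v p.1

open scoped Classical in
/-- The vector `(v₁, …, vᵢ₋₁, a, b, vᵢ₊₁, …, vₙ)`, with `a` at `i₁` and `b` at `i₂`. -/
noncomputable def splitVector {V : Type} (v : V → A) (i : V) (a b : A) : CellGraph.SplitLabel V i → A :=
  fun p => if (ofLex p.1).1 = i then (if (ofLex p.1).2 = true then b else a) else v (ofLex p.1).1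

/-- The label `i₁` of the left vertex. -/
def leftLabel {V : Type} (i : V) : CellGraph.SplitLabel V i :=
  ⟨toLex (i, false), fun _ => rfl⟩

/-- The label `i₂` of the right vertex. -/
def rightLabel {V : Type} (i : V) : CellGraph.SplitLabel V i :=
  ⟨toLex (i, true), fun _ => rfl⟩

open scoped Classical in
theorem splitVector_left {V : Type} (v : V → A) (i : V) (a a' b : A) :
    splitVector v i a b = Function.update (splitVector v i a' b) (leftLabel i) a := by
  have key : ∀ (p : V) (c : Bool) (hp : c = true → p = i),
      splitVector v i a b ⟨toLex (p, c), hp⟩ =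
        Function.update (splitVector v i a' b) (leftLabel i) a ⟨toLex (p, c), hp⟩ := by
    intro p c hp
    have e : (⟨toLex (p, c), hp⟩ : CellGraph.SplitLabel V i) = leftLabel i ↔ p = i ∧ c = false :=
      Subtype.ext_iff.trans (toLex_inj.trans Prod.mk_inj)
    rw [Function.update_apply]
    split_ifs with h
    · obtain ⟨rfl, rfl⟩ := e.1 h
      simp [splitVector]
    · rw [e] at h
      cases c <;> simp_all [splitVector]
  funext p
  exact key (ofLex p.1).1 (ofLex p.1).2 p.2

open scoped Classical in
theorem splitVector_right {V : Type} (v : V → A) (i : V) (a b b' : A) :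
    splitVector v i a b = Function.update (splitVector v i a b') (rightLabel i) b := by
  have key : ∀ (p : V) (c : Bool) (hp : c = true → p = i),
      splitVector v i a b ⟨toLex (p, c), hp⟩ =
        Function.update (splitVector v i a b') (rightLabel i) b ⟨toLex (p, c), hp⟩ := by
    intro p c hp
    have e : (⟨toLex (p, c), hp⟩ : CellGraph.SplitLabel V i) = rightLabel i ↔ p = i ∧ c = true :=
      Subtype.ext_iff.trans (toLex_inj.trans Prod.mk_inj)
    rw [Function.update_apply]
    split_ifs with h
    · obtain ⟨rfl, rfl⟩ := e.1 h
      simp [splitVector]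
    · rw [e] at h
      cases c <;> simp_all [splitVector]
  funext p
  exact key (ofLex p.1).1 (ofLex p.1).2 p.2

open scoped Classical in
/-- The bilinear map `(a, b) ↦ f(v₁, …, vᵢ₋₁, a, b, vᵢ₊₁, …, vₙ)`. -/
noncomputable def insertPair {V : Type} (i : V)
    (f : MultilinearMap K (fun _ : CellGraph.SplitLabel V i => A) K) (v : V → A) :
    A →ₗ[K] A →ₗ[K] K :=
  LinearMap.mk₂ K (fun a b => f (splitVector v i a b))
    (fun a a' b => by
      rw [splitVector_left v i (a + a') 0 b, f.map_update_add, ← splitVector_left,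
        ← splitVector_left])
    (fun c a b => by
      rw [splitVector_left v i (c • a) 0 b, f.map_update_smul, ← splitVector_left])
    (fun a b b' => by
      rw [splitVector_right v i a (b + b') 0, f.map_update_add, ← splitVector_right,
        ← splitVector_right])
    (fun c a b => by
      rw [splitVector_right v i a (c • b) 0, f.map_update_smul, ← splitVector_right])

/-- An ECO functor, evaluated at the Frobenius object `(A, ε)`. It assigns to each cell graph `γ`
with a finite totally ordered set `V` of labels a linear map `A^{⊗V} → K` (a multilinear form), such
that isomorphic cell graphs have the same form, the graph `•` with one vertex and no edge has the
form `ε`, disjoint unions go to tensor products (monoidality, with the empty graph going to `1`),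
and edge-contractions of connected cell graphs go to morphisms of objects over `K`: for ECO 1 along
an edge from `pᵢ` to `pⱼ` the morphism `A^{⊗n} → A^{⊗(n-1)}` is the multiplication of the `i`-th and
`j`-th factors, and for ECO 2 along a loop at `pᵢ` the morphism `A^{⊗n} → A^{⊗(n+1)}` is the
comultiplication of the `i`-th factor. -/
structure ECOFunctorAt [FiniteDimensional K A] (F : FrobeniusStructure K A) where
  /-- The form `ω_A(γ)`. -/
  form : ∀ {V : Type} [LinearOrder V] [Finite V],
    CellGraph V → MultilinearMap K (fun _ : V => A) K
  form_iso : ∀ {V W : Type} [LinearOrder V] [Finite V] [LinearOrder W] [Finite W]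
    (γ : CellGraph V) (γ' : CellGraph W) (e : γ.Iso γ') (w : W → A),
    form γ (fun p => w (e.label p)) = form γ' w
  form_point : ∀ v : Fin 1 → A, form (CellGraph.edgeless (Fin 1)) v = F.counit (v 0)
  form_empty : ∀ v : Fin 0 → A, form (CellGraph.edgeless (Fin 0)) v = 1
  form_disjoint_union : ∀ {V : Type} [LinearOrder V] [Finite V] (γ : CellGraph V) (S : Set V)
    (hS : γ.IsUnionOfComponents S) (v : V → A),
    form γ v = form (γ.restrict S hS) (fun p => v p) *
      form (γ.restrict Sᶜ hS.compl) (fun p => v p)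
  /-- ECO 1 -/
  form_contractEdge : ∀ {V : Type} [LinearOrder V] [Finite V] (γ : CellGraph V), γ.Connected →
    ∀ (h : γ.HalfEdge) (hne : γ.vertex h ≠ γ.vertex (γ.flip h)) (v : V → A),
    form γ v = form (γ.contractEdge h hne) (mergeVector v (γ.vertex h) (γ.vertex (γ.flip h)))
  /-- ECO 2 -/
  form_contractLoop : ∀ {V : Type} [LinearOrder V] [Finite V] (γ : CellGraph V), γ.Connected →
    ∀ (h : γ.HalfEdge) (hloop : γ.vertex (γ.flip h) = γ.vertex h) (v : V → A),
    form γ v = TensorProduct.lift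
      (insertPair (γ.vertex h) (form (γ.contractLoop h hloop)) v) (F.comul (v (γ.vertex h)))

end ECO

/-! Every contraction removes two half-edges, so the formula follows by strong induction on their
number. The induction statement `exists_genus_and_form` does not presuppose a genus: it produces
some `g` with `χ = 2 - 2g` together with the formula, and at the end `χ` identifies this `g` with
the given one.

An edge between distinct vertices is contracted by ECO 1; neither the product of the vectors nor `χ`
changes. If all edges are loops, connectedness leaves a single vertex. Without half-edges the form
is `ε`; otherwise ECO 2 applies and raises `χ` by 2. If the two new vertices are still joined, the
genus has dropped by one and `m(δ(v)) = v e` (`mul'_comul`) supplies the missing Euler factor. If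
they are separated, Euler characteristics add, so `g = g₁ + g₂`, and pairing `δ(v)` with `e^g₁ ⊗
e^g₂` gives `ε(v e^(g₁ + g₂))` (`lift_counitMulPair_comul`).

The combinatorial input is `eulerChar_contractEdge` and `eulerChar_contractLoop`. Contraction
deletes `h` and `flip h` from the cycles of `rot * flip`, so the only cycles lost lie inside this
pair. Each lost cycle is matched by a vertex that becomes isolated and receives a face by
convention. -/

namespace FrobeniusStructure

/-! ### Identities for the comultiplication and the Euler element. -/

variable {K A : Type*} [Field K] [CommRing A] [Algebra K A]

/-- The bilinear form `(a, b) ↦ ε(a x) ε(b y)`. -/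
noncomputable def counitMulPair (F : FrobeniusStructure K A) (x y : A) : A →ₗ[K] A →ₗ[K] K :=
  (LinearMap.mul K K).compl₁₂ (F.counit ∘ₗ LinearMap.mulRight K x)
    (F.counit ∘ₗ LinearMap.mulRight K y)

theorem counitMulPair_apply (F : FrobeniusStructure K A) (x y a b : A) :
    F.counitMulPair x y a b = F.counit (a * x) * F.counit (b * y) := rfl

variable [FiniteDimensional K A]

theorem toDual_apply (F : FrobeniusStructure K A) (u v : A) :
    F.toDual u v = F.counit (u * v) := rfl

theorem dualDistrib_congr_comul (F : FrobeniusStructure K A) (u : A) :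
    TensorProduct.dualDistrib K A A (TensorProduct.congr F.toDual F.toDual (F.comul u)) =
      Module.Dual.transpose (LinearMap.mul' K A) (F.toDual u) := by
  have h : TensorProduct.congr F.toDual F.toDual (F.comul u) =
      (TensorProduct.dualDistribEquiv K A A).symm
        (Module.Dual.transpose (LinearMap.mul' K A) (F.toDual u)) := by
    simp [comul]
  rw [h]
  exact (TensorProduct.dualDistribEquiv K A A).apply_symm_apply _

theorem lift_counitMulPair (F : FrobeniusStructure K A) (x y : A) (t : A ⊗[K] A) :
    TensorProduct.lift (F.counitMulPair x y) t =
      TensorProduct.dualDistrib K A A (TensorProduct.congr F.toDual F.toDual t) (x ⊗ₜ y) := by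
  induction t with
  | zero => simp
  | tmul a b => simp [counitMulPair_apply, toDual_apply]
  | add s t hs ht => simp only [map_add, hs, ht, LinearMap.add_apply]

/-- This is the relation `(λ ⊗ λ) ∘ δ = m* ∘ λ` evaluated on `x ⊗ y`. All later facts about `δ` are
drawn from it. -/
theorem lift_counitMulPair_comul (F : FrobeniusStructure K A) (x y u : A) :
    TensorProduct.lift (F.counitMulPair x y) (F.comul u) = F.counit (u * (x * y)) := by
  rw [lift_counitMulPair, dualDistrib_congr_comul]
  rfl

/-- In finite dimension `λ ⊗ λ` and `A* ⊗ A* → (A ⊗ A)*` are both injective, so pairings with pure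
tensors separate tensors. -/
theorem eq_of_lift_counitMulPair (F : FrobeniusStructure K A) {s t : A ⊗[K] A}
    (h : ∀ x y, TensorProduct.lift (F.counitMulPair x y) s =
      TensorProduct.lift (F.counitMulPair x y) t) : s = t := by
  apply (TensorProduct.congr F.toDual F.toDual).injective
  apply (TensorProduct.dualDistribEquiv K A A).injective
  refine TensorProduct.ext' fun x y => ?_
  have := h x y
  rw [lift_counitMulPair, lift_counitMulPair] at this
  exact this

/-- Linearity of `δ` over `A`: a factor `u` in the first leg can be moved into `x`, and both sides
then pair with `x ⊗ y` to `ε(uxy)`. -/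
theorem comul_eq (F : FrobeniusStructure K A) (u : A) :
    F.comul u = TensorProduct.map (LinearMap.mulLeft K u) LinearMap.id (F.comul 1) := by
  apply F.eq_of_lift_counitMulPair
  intro x y
  have h : TensorProduct.lift (F.counitMulPair x y) ∘ₗ
      TensorProduct.map (LinearMap.mulLeft K u) LinearMap.id =
        TensorProduct.lift (F.counitMulPair (u * x) y) := by
    refine TensorProduct.ext' fun a b => ?_
    simp only [LinearMap.comp_apply, TensorProduct.map_tmul, TensorProduct.lift.tmul,
      counitMulPair_apply, LinearMap.mulLeft_apply, LinearMap.id_apply]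
    congr 2
    ring
  rw [← LinearMap.comp_apply (TensorProduct.lift _) (TensorProduct.map _ _), h,
    lift_counitMulPair_comul, lift_counitMulPair_comul]
  congr 1
  ring

theorem mul'_comul (F : FrobeniusStructure K A) (u : A) :
    LinearMap.mul' K A (F.comul u) = u * F.euler := by
  rw [comul_eq, euler]
  generalize F.comul 1 = t
  induction t with
  | zero => simp
  | tmul a b => simp [mul_assoc]
  | add s t hs ht => simp only [map_add, hs, ht, mul_add]

end FrobeniusStructure

namespace CellGraph

/-! ### Counting cycles of permutations. -/

section Permutations

variable {α : Type}

/-- The number of cycles of a permutation, fixed points included. -/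
noncomputable def numCycles (σ : Equiv.Perm α) : ℕ :=
  Nat.card (Quotient (Equiv.Perm.SameCycle.setoid σ))

/-- The cycles of `σ` that meet `p` correspond to the cycles of a permutation of `p` that has
the same orbits. -/
noncomputable def cyclesEquiv (σ : Equiv.Perm α) (p : α → Prop) (τ : Equiv.Perm {x // p x})
    (h : ∀ x y, τ.SameCycle x y ↔ σ.SameCycle x y) :
    Quotient (Equiv.Perm.SameCycle.setoid τ) ≃
      {q : Quotient (Equiv.Perm.SameCycle.setoid σ) // ∃ x, p x ∧ Quotient.mk _ x = q} :=
  Equiv.ofBijective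
    (Quotient.lift (fun x => ⟨Quotient.mk _ x.1, x.1, x.2, rfl⟩) fun x y e =>
      Subtype.ext (Quotient.sound ((h x y).1 e)))
    (by
      constructor
      · rintro ⟨x⟩ ⟨y⟩ e
        exact Quotient.sound ((h x y).2 (Quotient.exact (congrArg Subtype.val e)))
      · rintro ⟨_, x, hx, rfl⟩
        exact ⟨Quotient.mk _ ⟨x, hx⟩, rfl⟩)

/-- A cycle of `σ` either meets `p`, and is then counted by `τ`, or avoids it. Only orbits are
compared, so `τ` may skip over points of `σ` outside `p`. -/
theorem numCycles_eq_add [Finite α] (σ : Equiv.Perm α) (p : α → Prop) (τ : Equiv.Perm {x // p x})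
    (h : ∀ x y, τ.SameCycle x y ↔ σ.SameCycle x y) :
    numCycles σ = numCycles τ +
      {q : Quotient (Equiv.Perm.SameCycle.setoid σ) |
        ¬ ∃ x, p x ∧ Quotient.mk _ x = q}.ncard := by
  classical
  rw [numCycles, numCycles, Nat.card_congr (cyclesEquiv σ p τ h), ← Nat.card_coe_set_eq,
    ← Nat.card_sum]
  exact Nat.card_congr (Equiv.sumCompl _).symm

theorem numCycles_eq_add_compl [Finite α] (σ : Equiv.Perm α) (p : α → Prop)
    (hp : ∀ x, p (σ x) ↔ p x) :
    numCycles σ = numCycles (σ.subtypePerm hp) +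
      numCycles (σ.subtypePerm (p := fun x => ¬ p x) fun x => not_congr (hp x)) := by
  rw [numCycles_eq_add σ p (σ.subtypePerm hp) fun x y => Equiv.Perm.sameCycle_subtypePerm]
  congr 1
  rw [numCycles, Nat.card_congr (cyclesEquiv σ (fun x => ¬ p x)
    (σ.subtypePerm (p := fun x => ¬ p x) fun x => not_congr (hp x))
    fun x y => Equiv.Perm.sameCycle_subtypePerm), ← Nat.card_coe_set_eq]
  refine Nat.card_congr (Equiv.subtypeEquivRight fun q => ?_)
  -- By invariance `p` is constant on cycles, so missing `p` is the same as meeting its complement.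
  have inv : ∀ x y, σ.SameCycle x y → (p x ↔ p y) := by
    intro x y e
    obtain ⟨n, rfl⟩ := e.exists_nat_pow_eq
    clear e
    induction n with
    | zero => rfl
    | succ n ih => rw [pow_succ', Equiv.Perm.mul_apply, hp]; exact ih
  induction q using Quotient.inductionOn with
  | h z =>
    constructor
    · intro hz
      exact ⟨z, fun h => hz ⟨z, h, rfl⟩, rfl⟩
    · rintro ⟨x, hx, e⟩ ⟨y, hy, e'⟩
      exact hx ((inv y x (Quotient.exact (e'.trans e.symm))).1 hy)

theorem sameCycle_subset_pair_iff [Finite α] (σ : Equiv.Perm α) {a b : α} (hab : a ≠ b) :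
    (∀ x, σ.SameCycle a x → x = a ∨ x = b) ↔ σ a = a ∨ (σ a = b ∧ σ b = a) := by
  constructor
  · intro h
    rcases h (σ a) ⟨1, by simp⟩ with e | e
    · exact Or.inl e
    · refine Or.inr ⟨e, ?_⟩
      rcases h (σ b) ⟨2, by rw [← e, zpow_ofNat, pow_two]; rfl⟩ with e' | e'
      · exact e'
      · exact absurd (σ.injective (e.trans e'.symm)) hab
  · rintro h x e
    obtain ⟨n, rfl⟩ := e.exists_nat_pow_eq
    clear e
    induction n with
    | zero => exact Or.inl rfl
    | succ n ih =>
      rw [pow_succ', Equiv.Perm.mul_apply]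
      rcases h with h | ⟨h, h'⟩
      · have : ∀ n : ℕ, (σ ^ n) a = a := fun n => by
          induction n with
          | zero => rfl
          | succ n ih => rw [pow_succ', Equiv.Perm.mul_apply, ih, h]
        rw [this, h]
        exact Or.inl rfl
      · rcases ih with e | e <;> rw [e]
        · exact Or.inr h
        · exact Or.inl h'

-- A cycle inside `{a, b}` is the fixed point `a`, the fixed point `b` or the transposition of the
-- two.
open scoped Classical in
theorem ncard_cycles_subset_pair [Finite α] (σ : Equiv.Perm α) {a b : α} (hab : a ≠ b) :
    {q : Quotient (Equiv.Perm.SameCycle.setoid σ) |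
        ¬ ∃ x, (x ≠ a ∧ x ≠ b) ∧ Quotient.mk _ x = q}.ncard =
      (if σ a = a then 1 else 0) + (if σ b = b then 1 else 0) +
        (if σ a = b ∧ σ b = a then 1 else 0) := by
  have mem : ∀ z, (¬ ∃ x, (x ≠ a ∧ x ≠ b) ∧
      (Quotient.mk (Equiv.Perm.SameCycle.setoid σ) x) = Quotient.mk _ z) ↔
        ∀ x, σ.SameCycle z x → x = a ∨ x = b := by
    intro z
    constructor
    · intro h x e
      by_contra hc
      exact h ⟨x, not_or.1 hc, Quotient.sound e.symm⟩
    · rintro h ⟨x, hx, e⟩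
      exact (not_or.2 hx) (h x (Quotient.exact e).symm)
  have ha := sameCycle_subset_pair_iff σ hab
  have hb := sameCycle_subset_pair_iff σ hab.symm
  have hb' : (∀ x, σ.SameCycle b x → x = a ∨ x = b) ↔ σ b = b ∨ (σ b = a ∧ σ a = b) := by
    rw [← hb]
    simp only [or_comm]
  have key : {q : Quotient (Equiv.Perm.SameCycle.setoid σ) |
      ¬ ∃ x, (x ≠ a ∧ x ≠ b) ∧ Quotient.mk _ x = q} =
        {q | (q = Quotient.mk _ a ∧ (σ a = a ∨ (σ a = b ∧ σ b = a))) ∨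
          (q = Quotient.mk _ b ∧ (σ b = b ∨ (σ b = a ∧ σ a = b)))} := by
    ext q
    induction q using Quotient.inductionOn with
    | h z =>
      rw [Set.mem_ofPred_eq, Set.mem_ofPred_eq, mem]
      constructor
      · intro h
        rcases h z (Equiv.Perm.SameCycle.refl _ _) with rfl | rfl
        · exact Or.inl ⟨rfl, ha.1 h⟩
        · exact Or.inr ⟨rfl, hb'.1 h⟩
      · rintro (⟨e, h⟩ | ⟨e, h⟩)
        · exact fun x hx => ha.2 h x ((Quotient.exact e).symm.trans hx)
        · exact fun x hx => hb'.2 h x ((Quotient.exact e).symm.trans hx)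
  rw [key]
  by_cases h1 : σ a = a
  · have h2 : σ b ≠ a := fun e => hab (σ.injective (h1.trans e.symm))
    by_cases h3 : σ b = b
    · have hne : (Quotient.mk (Equiv.Perm.SameCycle.setoid σ) a) ≠ Quotient.mk _ b := fun e =>
        hab ((Quotient.exact e : σ.SameCycle a b).eq_of_left h1)
      simp only [h1, h3, hab, hab.symm, true_or, and_true, and_false, if_true, if_false]
      exact Set.ncard_pair hne
    · simp [h1, h2, h3, hab]
  · by_cases h3 : σ b = b
    · have h2 : σ a ≠ b := fun e => hab (σ.injective (e.trans h3.symm))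
      simp [h1, h2, h3]
    · by_cases h4 : σ a = b ∧ σ b = a
      · have he : (Quotient.mk (Equiv.Perm.SameCycle.setoid σ) b) = Quotient.mk _ a :=
          Quotient.sound (⟨1, by simp [h4.2]⟩ : σ.SameCycle b a)
        simp [h4.1, h4.2, he, hab, hab.symm]
      · have h4' : ¬ (σ b = a ∧ σ a = b) := fun h => h4 h.symm
        simp [h1, h3, h4, h4']

/-- Let `m` be the first time the `σ`-orbit of `a` reaches `b`. The new permutation returns to `a`
at time `m`, so its orbit of `a` stays among the `σ ^ k a` with `k < m`, which avoid `b`. -/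
theorem not_sameCycle_swap_mul [Finite α] [DecidableEq α] (σ : Equiv.Perm α) {a b : α}
    (hab : a ≠ b) (h : σ.SameCycle a b) : ¬ (Equiv.swap a b * σ).SameCycle a b := by
  have hex := h.exists_nat_pow_eq
  set m := Nat.find hex with hm
  have hmb : (σ ^ m) a = b := Nat.find_spec hex
  have hlt : ∀ k < m, (σ ^ k) a ≠ b := fun k hk => Nat.find_min hex hk
  have hm0 : m ≠ 0 := fun e => hab (by rw [e] at hmb; exact hmb)
  -- A return to `a` at time `k` would bring `b` within reach `k` steps earlier.
  have hna : ∀ k, 0 < k → k < m → (σ ^ k) a ≠ a := by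
    intro k h0 hk e
    refine hlt (m - k) (by omega) ?_
    rw [← hmb]
    conv_rhs => rw [show m = (m - k) + k by omega, pow_add, Equiv.Perm.mul_apply, e]
  intro hs
  obtain ⟨n, hn⟩ := hs.exists_nat_pow_eq
  have key : ∀ n : ℕ, ∃ k < m, ((Equiv.swap a b * σ) ^ n) a = (σ ^ k) a := by
    intro n
    induction n with
    | zero => exact ⟨0, by omega, rfl⟩
    | succ n ih =>
      obtain ⟨k, hk, e⟩ := ih
      rw [pow_succ', Equiv.Perm.mul_apply, e, Equiv.Perm.mul_apply, ← Equiv.Perm.mul_apply,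
        ← Equiv.Perm.mul_apply, mul_assoc, ← pow_succ', Equiv.Perm.mul_apply]
      by_cases hk' : k + 1 = m
      · rw [hk', hmb, Equiv.swap_apply_right]
        exact ⟨0, by omega, rfl⟩
      · exact ⟨k + 1, by omega, Equiv.swap_apply_of_ne_of_ne (hna _ (by omega) (by omega))
          (hlt _ (by omega))⟩
  obtain ⟨k, hk, e⟩ := key n
  exact hlt k hk (e.symm.trans hn)

end Permutations

end CellGraph

/-! ### The Euler characteristic under contraction and restriction. -/

namespace CellGraph

/-- Serves the face permutation of a contracted graph, a product of two restricted permutations that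
agrees with a permutation of all half-edges only pointwise. -/
theorem sameCycle_iff_of_apply_val {α : Type} [Finite α] {p : α → Prop} {τ : Equiv.Perm {x // p x}}
    {σ : Equiv.Perm α} (h : ∀ x, (τ x : α) = σ x) (x y : {x // p x}) :
    τ.SameCycle x y ↔ σ.SameCycle x y := by
  have key : ∀ n : ℕ, (((τ ^ n) x : {x // p x}) : α) = (σ ^ n) x := by
    intro n
    induction n with
    | zero => rfl
    | succ n ih => rw [pow_succ', pow_succ', Equiv.Perm.mul_apply, Equiv.Perm.mul_apply, h, ih]
  constructor
  · intro e
    obtain ⟨n, rfl⟩ := e.exists_nat_pow_eq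
    exact ⟨n, by rw [zpow_natCast, key]⟩
  · intro e
    obtain ⟨n, hn⟩ := e.exists_nat_pow_eq
    exact ⟨n, by rw [zpow_natCast]; exact Subtype.ext ((key n).trans hn)⟩

variable {V : Type}

/-- The number of vertices without half-edges. -/
noncomputable def numIsolated (γ : CellGraph V) : ℕ := {p | p ∉ Set.range γ.vertex}.ncard

theorem eulerChar_eq [Finite V] (γ : CellGraph V) :
    γ.eulerChar = (Nat.card V : ℤ) - numCycles γ.flip +
      (numCycles (γ.rot * γ.flip) + γ.numIsolated) := by
  have := γ.finite
  rw [eulerChar, Edge, Face, Nat.card_sum, numCycles, numCycles, numIsolated,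
    ← Nat.card_coe_set_eq]
  push_cast
  rfl

theorem numCycles_flip (γ : CellGraph V) (h : γ.HalfEdge) :
    numCycles γ.flip = numCycles (γ.contractFlip h) + 1 := by
  classical
  have := γ.finite
  rw [numCycles_eq_add γ.flip _ (γ.contractFlip h) fun x y => Equiv.Perm.sameCycle_subtypePerm,
    ncard_cycles_subset_pair γ.flip (γ.flip_ne h).symm]
  simp [γ.flip_ne, γ.flip_flip, (γ.flip_ne h).symm]

-- Walking around a face of the contracted graph is walking around the old face and omitting the
-- contracted edge. This holds for loops and non-loops alike.
open scoped Classical in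
theorem contractRot_mul_contractFlip_apply (γ : CellGraph V)
    (h : γ.HalfEdge) (x : γ.Remaining h) :
    ((γ.contractRot h * γ.contractFlip h) x : γ.HalfEdge) =
      skip (skip (γ.rot * γ.flip) h) (γ.flip h) x := by
  obtain ⟨x, hx1, hx2⟩ := x
  have hy1 : γ.flip x ≠ h := fun e => hx2 (by rw [← e, γ.flip_flip])
  have hy2 : γ.flip x ≠ γ.flip h := fun e => hx1 (γ.flip.injective e)
  have hh := γ.flip_ne h
  -- The values of `rot` and `flip` are generalized below; these inequalities keep the injectivity
  -- that the case analysis of the swaps needs.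
  have r1 : γ.rot (γ.flip x) ≠ γ.rot h := fun e => hy1 (γ.rot.injective e)
  have r2 : γ.rot (γ.flip x) ≠ γ.rot (γ.flip h) := fun e => hy2 (γ.rot.injective e)
  have r3 : γ.rot h ≠ γ.rot (γ.flip h) := fun e => hh (γ.rot.injective e).symm
  change skip (skip (γ.shrinkRot h) h) (γ.flip h) (γ.flip x) = _
  simp only [skip, shrinkRot, Equiv.Perm.mul_apply, γ.flip_flip]
  generalize γ.rot (γ.flip x) = a at *
  generalize γ.rot h = b at *
  generalize γ.rot (γ.flip h) = c at *
  generalize γ.flip h = k at *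
  simp only [Equiv.swap_apply_def]
  grind

-- The three corrections are the face cycles `(h)`, `(flip h)` and `(h flip h)`. The last occurs
-- when both ends of the edge have valence one.
open scoped Classical in
theorem numCycles_rot_mul_flip (γ : CellGraph V) (h : γ.HalfEdge) :
    numCycles (γ.rot * γ.flip) = numCycles (γ.contractRot h * γ.contractFlip h) +
      ((if γ.rot (γ.flip h) = h then 1 else 0) + (if γ.rot h = γ.flip h then 1 else 0) +
        (if γ.rot h = h ∧ γ.rot (γ.flip h) = γ.flip h then 1 else 0)) := by
  have := γ.finite
  rw [numCycles_eq_add (γ.rot * γ.flip) _ (γ.contractRot h * γ.contractFlip h) fun x y => by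
      rw [sameCycle_iff_of_apply_val (γ.contractRot_mul_contractFlip_apply h) x y,
        sameCycle_skip _ x.2.2 y.2.2, sameCycle_skip _ x.2.1 y.2.1],
    ncard_cycles_subset_pair _ (γ.flip_ne h).symm]
  simp only [Equiv.Perm.mul_apply, γ.flip_flip]
  congr 3
  exact propext and_comm

theorem card_remaining_lt (γ : CellGraph V) (h : γ.HalfEdge) :
    Nat.card (γ.Remaining h) < Nat.card γ.HalfEdge := by
  have := γ.finite
  exact Finite.card_subtype_lt (x := h) fun hx => hx.1 rfl

/-! ### Contraction of an edge that is not a loop -/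

section ContractEdge

variable (γ : CellGraph V) (h : γ.HalfEdge) (hne : γ.vertex h ≠ γ.vertex (γ.flip h))

open scoped Classical in
theorem contractEdge_vertex_val (x : γ.Remaining h) :
    ((γ.contractEdge h hne).vertex x : V) =
      if γ.vertex x = γ.vertex (γ.flip h) then γ.vertex h else γ.vertex x := by
  change (dite _ _ _ : {p : V // p ≠ γ.vertex (γ.flip h)}).1 = _
  split_ifs <;> rfl

open scoped Classical in
theorem numIsolated_contractEdge [Finite V] :
    (γ.contractEdge h hne).numIsolated = γ.numIsolated +
      (if γ.rot h = h ∧ γ.rot (γ.flip h) = γ.flip h then 1 else 0) := by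
  have := γ.finite
  have hv := γ.contractEdge_vertex_val h hne
  have hnot : ∀ p, p ∉ Set.range γ.vertex → p ≠ γ.vertex h ∧ p ≠ γ.vertex (γ.flip h) :=
    fun p hp => ⟨fun e => hp ⟨h, e.symm⟩, fun e => hp ⟨_, e.symm⟩⟩
  -- The merged vertex has no half-edge exactly when both ends of the contracted edge had valence
  -- one.
  have hi : (⟨γ.vertex h, hne⟩ : {p : V // p ≠ γ.vertex (γ.flip h)}) ∉
      Set.range (γ.contractEdge h hne).vertex ↔
        (γ.rot h = h ∧ γ.rot (γ.flip h) = γ.flip h) := by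
    constructor
    · intro hr
      have key : ∀ x, x ≠ h → x ≠ γ.flip h →
          γ.vertex x ≠ γ.vertex h ∧ γ.vertex x ≠ γ.vertex (γ.flip h) := by
        intro x h1 h2
        constructor <;> intro e <;> refine hr ⟨⟨x, h1, h2⟩, Subtype.ext ?_⟩ <;> rw [hv] <;>
          simp [e]
      constructor
      · by_contra hc
        refine (key (γ.rot h) hc fun e => hne ?_).1 (γ.vertex_rot h)
        rw [← e, γ.vertex_rot]
      · by_contra hc
        refine (key (γ.rot (γ.flip h)) (fun e => hne ?_) hc).2 (γ.vertex_rot _)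
        conv_lhs => rw [← e, γ.vertex_rot]
    · rintro ⟨h1, h2⟩ ⟨(x : γ.Remaining h), hx⟩
      have hx := (hv x).symm.trans (congrArg Subtype.val hx)
      have : γ.vertex x = γ.vertex h ∨ γ.vertex x = γ.vertex (γ.flip h) := by
        split_ifs at hx with h3
        · exact Or.inr h3
        · exact Or.inl hx
      rcases this with e | e
      · exact x.2.1 ((((γ.vertex_eq_iff _ _).1 e).symm).eq_of_left h1).symm
      · exact x.2.2 ((((γ.vertex_eq_iff _ _).1 e).symm).eq_of_left h2).symm
  -- The isolated vertices are compared inside `V`: away from the merged vertex nothing changes.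
  have himg : Subtype.val '' {p | p ∉ Set.range (γ.contractEdge h hne).vertex} =
      if γ.rot h = h ∧ γ.rot (γ.flip h) = γ.flip h
        then insert (γ.vertex h) {p | p ∉ Set.range γ.vertex}
        else {p | p ∉ Set.range γ.vertex} := by
    have hother : ∀ p : {p : V // p ≠ γ.vertex (γ.flip h)}, p.1 ≠ γ.vertex h →
        (p ∉ Set.range (γ.contractEdge h hne).vertex ↔ p.1 ∉ Set.range γ.vertex) := by
      intro p hp
      refine not_congr ⟨?_, ?_⟩
      · rintro ⟨x, rfl⟩
        have hx := hv x
        split_ifs at hx with h3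
        · exact absurd hx hp
        · exact ⟨_, hx.symm⟩
      · rintro ⟨x, hx⟩
        refine ⟨⟨x, fun e => hp (by rw [← hx, e]), fun e => p.2 (by rw [← hx, e])⟩,
          Subtype.ext ?_⟩
        rw [hv, if_neg (by rw [hx]; exact p.2), hx]
    have hsub : ∀ p, p ∉ Set.range γ.vertex →
        p ∈ Subtype.val '' {p | p ∉ Set.range (γ.contractEdge h hne).vertex} := fun p hp =>
      ⟨⟨p, (hnot p hp).2⟩, (hother ⟨p, (hnot p hp).2⟩ (hnot p hp).1).2 hp, rfl⟩
    split_ifs with hc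
    · refine Set.Subset.antisymm ?_ (Set.insert_subset ⟨_, hi.2 hc, rfl⟩ hsub)
      rintro _ ⟨p, hp, rfl⟩
      by_cases e : p.1 = γ.vertex h
      · exact Or.inl e
      · exact Or.inr ((hother p e).1 hp)
    · refine Set.Subset.antisymm ?_ hsub
      rintro _ ⟨p, hp, rfl⟩
      by_cases e : p.1 = γ.vertex h
      · exact absurd ((show p = ⟨γ.vertex h, hne⟩ from Subtype.ext e) ▸ hp) (mt hi.1 hc)
      · exact (hother p e).1 hp
  rw [numIsolated, ← Set.ncard_image_of_injective _ Subtype.val_injective, himg, numIsolated]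
  split_ifs with hc
  · exact Set.ncard_insert_of_notMem fun hp => (hnot _ hp).1 rfl
  · rfl

/-- One vertex and one edge disappear. As `h` is not a loop, only the face cycle `(h flip h)` can be
lost, and then the merged vertex becomes isolated and contributes a face instead. -/
theorem eulerChar_contractEdge [Finite V] :
    (γ.contractEdge h hne).eulerChar = γ.eulerChar := by
  classical
  rw [eulerChar_eq, eulerChar_eq, numIsolated_contractEdge, numCycles_flip γ h,
    numCycles_rot_mul_flip γ h]
  change _ - (numCycles (γ.contractFlip h) : ℤ) +
    (numCycles (γ.contractRot h * γ.contractFlip h) + _) = _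
  have hV : Nat.card V = Nat.card {p : V // p ≠ γ.vertex (γ.flip h)} + 1 := by
    rw [← Nat.card_congr (Equiv.sumCompl fun p => p ≠ γ.vertex (γ.flip h)), Nat.card_sum]
    congr 1
    have : Unique {p // ¬ p ≠ γ.vertex (γ.flip h)} :=
      { default := ⟨_, fun e => e rfl⟩
        uniq := fun p => Subtype.ext (not_not.1 p.2) }
    exact Nat.card_unique
  have h1 : γ.rot (γ.flip h) ≠ h := fun e => hne (by conv_lhs => rw [← e, γ.vertex_rot])
  have h2 : γ.rot h ≠ γ.flip h := fun e => hne (by rw [← e, γ.vertex_rot])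
  rw [hV, if_neg h1, if_neg h2]
  push_cast
  ring

/-- The map `f` identifying the two ends sends each edge to an edge or a point, hence paths to
paths, and it fixes the surviving labels. -/
theorem Connected.contractEdge (hγ : γ.Connected) : (γ.contractEdge h hne).Connected := by
  classical
  have hv := γ.contractEdge_vertex_val h hne
  let f : V → {p : V // p ≠ γ.vertex (γ.flip h)} := fun p =>
    if hp : p = γ.vertex (γ.flip h) then ⟨γ.vertex h, hne⟩ else ⟨p, hp⟩
  have hf : ∀ x : γ.Remaining h, (γ.contractEdge h hne).vertex x = f (γ.vertex x) := fun _ => rfl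
  have fh : f (γ.vertex h) = f (γ.vertex (γ.flip h)) := by
    simp only [f, dif_neg hne, dif_pos]
  have step : ∀ p q, γ.toSimpleGraph.Adj p q →
      (γ.contractEdge h hne).toSimpleGraph.Reachable (f p) (f q) := by
    rintro p q ⟨-, x, rfl, rfl⟩
    by_cases h1 : x = h
    · rw [h1, fh]
    by_cases h2 : x = γ.flip h
    · rw [h2, γ.flip_flip, fh]
    by_cases e : f (γ.vertex x) = f (γ.vertex (γ.flip x))
    · rw [e]
    refine SimpleGraph.Adj.reachable ⟨e, (⟨x, h1, h2⟩ : γ.Remaining h), hf _, ?_⟩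
    exact hf (γ.contractFlip h ⟨x, h1, h2⟩)
  have reach : ∀ p q, γ.toSimpleGraph.Reachable p q →
      (γ.contractEdge h hne).toSimpleGraph.Reachable (f p) (f q) := by
    rintro p q ⟨w⟩
    induction w with
    | nil => exact SimpleGraph.Reachable.refl _
    | cons ha _ ih => exact (step _ _ ha).trans ih
  have : Nonempty {p : V // p ≠ γ.vertex (γ.flip h)} := ⟨⟨_, hne⟩⟩
  refine SimpleGraph.Connected.mk fun p q => ?_
  have := reach p q (hγ.preconnected p q)
  rwa [show f p = p from dif_neg p.2, show f q = q from dif_neg q.2] at this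

end ContractEdge

/-! ### Parts of a cell graph -/

theorem connected_of_subsingleton [Subsingleton V] [Nonempty V] (γ : CellGraph V) :
    γ.Connected :=
  SimpleGraph.Connected.mk fun p q => by rw [Subsingleton.elim p q]

/-- `rot` preserves vertices and `flip` preserves `S`, so edges, face cycles and isolated vertices
all split over `S` and its complement. -/
theorem eulerChar_restrict_add [Finite V] (γ : CellGraph V) (S : Set V)
    (hS : γ.IsUnionOfComponents S) :
    (γ.restrict S hS).eulerChar + (γ.restrict Sᶜ hS.compl).eulerChar = γ.eulerChar := by
  classical
  have := γ.finite
  have hS' : ∀ x, γ.vertex ((γ.rot * γ.flip) x) ∈ S ↔ γ.vertex x ∈ S := fun x => by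
    rw [Equiv.Perm.mul_apply, γ.vertex_rot]
    exact hS x
  have hV : Nat.card V = Nat.card S + Nat.card (Sᶜ : Set V) := by
    rw [← Nat.card_sum]
    exact Nat.card_congr (Equiv.Set.sumCompl S).symm
  have hE : numCycles γ.flip = numCycles (γ.restrict S hS).flip +
      numCycles (γ.restrict Sᶜ hS.compl).flip := numCycles_eq_add_compl γ.flip (fun x => γ.vertex x ∈ S) hS
  have hF : numCycles (γ.rot * γ.flip) =
      numCycles ((γ.restrict S hS).rot * (γ.restrict S hS).flip) +
        numCycles ((γ.restrict Sᶜ hS.compl).rot * (γ.restrict Sᶜ hS.compl).flip) :=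
    numCycles_eq_add_compl (γ.rot * γ.flip) (fun x => γ.vertex x ∈ S) hS'
  have range : ∀ (T : Set V) (hT : γ.IsUnionOfComponents T),
      Subtype.val '' {p | p ∉ Set.range (γ.restrict T hT).vertex} =
        {p | p ∉ Set.range γ.vertex} ∩ T := by
    intro T hT
    ext p
    constructor
    · rintro ⟨p, hp, rfl⟩
      refine ⟨?_, p.2⟩
      rintro ⟨x, hx⟩
      exact hp ⟨⟨x, by rw [hx]; exact p.2⟩, Subtype.ext hx⟩
    · rintro ⟨hp, hpT⟩
      refine ⟨⟨p, hpT⟩, ?_, rfl⟩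
      rintro ⟨x, hx⟩
      exact hp ⟨x.1, congrArg Subtype.val hx⟩
  have hI : γ.numIsolated =
      (γ.restrict S hS).numIsolated + (γ.restrict Sᶜ hS.compl).numIsolated := by
    rw [numIsolated, numIsolated, numIsolated,
      ← Set.ncard_image_of_injective {p | p ∉ Set.range (γ.restrict S hS).vertex}
        Subtype.val_injective,
      ← Set.ncard_image_of_injective {p | p ∉ Set.range (γ.restrict Sᶜ hS.compl).vertex}
        Subtype.val_injective, range, range]
    exact (Set.ncard_inter_add_ncard_sdiff_eq_ncard _ S).symm
  rw [eulerChar_eq, eulerChar_eq, eulerChar_eq, hV, hE, hF, hI]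
  push_cast
  ring

end CellGraph

/-! ### The two labels obtained by splitting a sole vertex. -/

theorem eq_leftLabel_or_eq_rightLabel {V : Type} [Subsingleton V] {i : V}
    (p : CellGraph.SplitLabel V i) : p = leftLabel i ∨ p = rightLabel i := by
  have key : ∀ (q : V) (c : Bool) (hq : c = true → q = i),
      (⟨toLex (q, c), hq⟩ : CellGraph.SplitLabel V i) = leftLabel i ∨
        (⟨toLex (q, c), hq⟩ : CellGraph.SplitLabel V i) = rightLabel i := by
    intro q c hq
    obtain rfl := Subsingleton.elim q i
    cases c
    · exact Or.inl rfl
    · exact Or.inr rfl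
  exact key (ofLex p.1).1 (ofLex p.1).2 p.2

theorem leftLabel_ne_rightLabel {V : Type} (i : V) : leftLabel i ≠ rightLabel i := fun e =>
  Bool.false_ne_true (congrArg (fun p : CellGraph.SplitLabel V i => (ofLex p.1).2) e)

theorem splitVector_leftLabel {V : Type} {A : Type*} [CommRing A] (v : V → A) (i : V) (a b : A) :
    splitVector v i a b (leftLabel i) = a := by
  simp [splitVector, leftLabel]

theorem splitVector_rightLabel {V : Type} {A : Type*} [CommRing A] (v : V → A) (i : V) (a b : A) :
    splitVector v i a b (rightLabel i) = b := by
  simp [splitVector, rightLabel]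

namespace CellGraph

variable {V : Type}

/-! ### Contraction of a loop at the only vertex -/

section ContractLoop

variable (γ : CellGraph V) (h : γ.HalfEdge) (hloop : γ.vertex (γ.flip h) = γ.vertex h)

theorem contractLoop_vertex_of_sameCycle [Subsingleton V] (x : γ.Remaining h)
    (hx : (γ.shrinkRot h).SameCycle h x) :
    (γ.contractLoop h hloop).vertex x = leftLabel (γ.vertex h) := by
  classical
  refine (dif_neg fun hc => hc.2 hx).trans (Subtype.ext ?_)
  exact congrArg (fun p => toLex (p, false)) (Subsingleton.elim _ _)

theorem contractLoop_vertex_of_not_sameCycle [Subsingleton V] (x : γ.Remaining h)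
    (hx : ¬ (γ.shrinkRot h).SameCycle h x) :
    (γ.contractLoop h hloop).vertex x = rightLabel (γ.vertex h) := by
  classical
  refine (dif_pos ⟨Subsingleton.elim _ _, hx⟩).trans (Subtype.ext ?_)
  exact congrArg (fun p => toLex (p, true)) (Subsingleton.elim _ _)

/-- The left vertex carries the `shrinkRot`-cycle of `h` without `h`, which is empty when
`shrinkRot` fixes `h`. Otherwise the successor of `h` is a witness; it is not `flip h`, because
shrinking a loop puts `h` and `flip h` in different cycles. -/
theorem leftLabel_notMem_range [Subsingleton V] :
    leftLabel (γ.vertex h) ∉ Set.range (γ.contractLoop h hloop).vertex ↔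
      γ.rot h = γ.flip h := by
  classical
  have hs : γ.rot.SameCycle h (γ.flip h) := (γ.vertex_eq_iff _ _).1 hloop.symm
  have := γ.finite
  have split := not_sameCycle_swap_mul γ.rot (γ.flip_ne h).symm hs
  have self : (γ.shrinkRot h).SameCycle h (γ.shrinkRot h h) := ⟨1, by simp⟩
  have e1 : γ.shrinkRot h h = Equiv.swap h (γ.flip h) (γ.rot h) := by
    simp [shrinkRot]
  constructor
  · intro hr
    by_contra hc
    have hfix : γ.shrinkRot h h ≠ h := fun e => hc (by
      rw [e1] at e
      simpa using congrArg (Equiv.swap h (γ.flip h)) e)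
    have hflip : γ.shrinkRot h h ≠ γ.flip h := fun e => split (by
      rw [e] at self
      exact self)
    exact hr ⟨(⟨_, hfix, hflip⟩ : γ.Remaining h),
      γ.contractLoop_vertex_of_sameCycle h hloop ⟨_, hfix, hflip⟩ self⟩
  · rintro e ⟨(x : γ.Remaining h), hx⟩
    rw [e, Equiv.swap_apply_right] at e1
    by_cases hc : (γ.shrinkRot h).SameCycle h x
    · exact x.2.1 (hc.eq_of_left e1).symm
    · exact leftLabel_ne_rightLabel _
        (hx.symm.trans (γ.contractLoop_vertex_of_not_sameCycle h hloop x hc))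

theorem rightLabel_notMem_range [Subsingleton V] :
    rightLabel (γ.vertex h) ∉ Set.range (γ.contractLoop h hloop).vertex ↔
      γ.rot (γ.flip h) = h := by
  classical
  have hs : γ.rot.SameCycle h (γ.flip h) := (γ.vertex_eq_iff _ _).1 hloop.symm
  have := γ.finite
  have split := not_sameCycle_swap_mul γ.rot (γ.flip_ne h).symm hs
  have self : (γ.shrinkRot h).SameCycle (γ.flip h) (γ.shrinkRot h (γ.flip h)) := ⟨1, by simp⟩
  have e1 : γ.shrinkRot h (γ.flip h) = Equiv.swap h (γ.flip h) (γ.rot (γ.flip h)) := by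
    simp [shrinkRot]
  constructor
  · intro hr
    by_contra hc
    have hfix : γ.shrinkRot h (γ.flip h) ≠ γ.flip h := fun e => hc (by
      rw [e1] at e
      simpa using congrArg (Equiv.swap h (γ.flip h)) e)
    have hnot : ¬ (γ.shrinkRot h).SameCycle h (γ.shrinkRot h (γ.flip h)) := fun e =>
      split (e.trans self.symm)
    have hne : γ.shrinkRot h (γ.flip h) ≠ h := fun e => hnot (by
      rw [e])
    exact hr ⟨(⟨_, hne, hfix⟩ : γ.Remaining h),
      γ.contractLoop_vertex_of_not_sameCycle h hloop ⟨_, hne, hfix⟩ hnot⟩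
  · rintro e ⟨(x : γ.Remaining h), hx⟩
    rw [e, Equiv.swap_apply_left] at e1
    by_cases hc : (γ.shrinkRot h).SameCycle h x
    · exact leftLabel_ne_rightLabel _
        ((γ.contractLoop_vertex_of_sameCycle h hloop x hc).symm.trans hx)
    -- With one vertex all half-edges form one `rot`-cycle, so what is not in the new cycle of `h`
    -- is in that of `flip h`.
    · have hx' : γ.rot.SameCycle x h := (γ.vertex_eq_iff _ _).1 (Subsingleton.elim _ _)
      have : (γ.shrinkRot h).SameCycle (γ.flip h) x := by
        rcases sameCycle_swap_mul γ.rot h (γ.flip h) hx' with e | ⟨e, -⟩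
        · exact absurd e.symm hc
        · exact e.resolve_left hc
      exact x.2.2 (this.eq_of_left e1).symm

open scoped Classical in
theorem numIsolated_contractLoop [Subsingleton V] :
    (γ.contractLoop h hloop).numIsolated =
      (if γ.rot (γ.flip h) = h then 1 else 0) + (if γ.rot h = γ.flip h then 1 else 0) := by
  have hl := γ.leftLabel_notMem_range h hloop
  have hr := γ.rightLabel_notMem_range h hloop
  have : {p | p ∉ Set.range (γ.contractLoop h hloop).vertex} =
      {p | p = leftLabel _ ∧ γ.rot h = γ.flip h ∨ p = rightLabel _ ∧ γ.rot (γ.flip h) = h} := by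
    ext p
    rw [Set.mem_ofPred_eq, Set.mem_ofPred_eq]
    rcases eq_leftLabel_or_eq_rightLabel p with rfl | rfl
    · rw [hl]
      simp [leftLabel_ne_rightLabel]
    · rw [hr]
      simp [(leftLabel_ne_rightLabel _).symm]
  rw [numIsolated, this]
  by_cases h1 : γ.rot h = γ.flip h <;> by_cases h2 : γ.rot (γ.flip h) = h <;> simp [h1, h2]
  exact Set.ncard_pair (leftLabel_ne_rightLabel _)

/-- One vertex more and one edge less give 2. The number of faces is unchanged: each lost face
cycle, `(h)` or `(flip h)`, leaves one of the new vertices isolated. -/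
theorem eulerChar_contractLoop [Subsingleton V] :
    (γ.contractLoop h hloop).eulerChar = γ.eulerChar + 2 := by
  classical
  rw [eulerChar_eq, eulerChar_eq, numIsolated_contractLoop, numCycles_flip γ h,
    numCycles_rot_mul_flip γ h]
  change _ - (numCycles (γ.contractFlip h) : ℤ) +
    (numCycles (γ.contractRot h * γ.contractFlip h) + _) = _
  have : Unique V := { default := γ.vertex h, uniq := fun _ => Subsingleton.elim _ _ }
  have hV : Nat.card (SplitLabel V (γ.vertex h)) = 2 :=
    Nat.card_eq_two_iff.2 ⟨_, _, leftLabel_ne_rightLabel (γ.vertex h),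
      Set.eq_univ_of_forall eq_leftLabel_or_eq_rightLabel⟩
  have hI : γ.numIsolated = 0 := by
    rw [numIsolated, Set.ncard_eq_zero]
    exact Set.eq_empty_of_forall_notMem fun p hp => hp ⟨h, Subsingleton.elim _ _⟩
  -- The cycle `(h flip h)` cannot be lost: `h` and `flip h` share a `rot`-cycle, so `rot` does not
  -- fix `h`.
  have hn : ¬ (γ.rot h = h ∧ γ.rot (γ.flip h) = γ.flip h) := fun e =>
    γ.flip_ne h ((((γ.vertex_eq_iff _ _).1 hloop.symm).eq_of_left e.1).symm)
  rw [hV, hI, if_neg hn, Nat.card_unique]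
  push_cast
  ring

end ContractLoop

theorem connected_of_adj_pair (γ : CellGraph V) {p q : V} (hV : ∀ r, r = p ∨ r = q)
    (x : γ.HalfEdge) (hx : γ.vertex x ≠ γ.vertex (γ.flip x)) : γ.Connected := by
  have hadj : γ.toSimpleGraph.Adj (γ.vertex x) (γ.vertex (γ.flip x)) := ⟨hx, x, rfl, rfl⟩
  have hpq : γ.toSimpleGraph.Reachable p q := by
    rcases hV (γ.vertex x) with e | e <;> rcases hV (γ.vertex (γ.flip x)) with e' | e' <;>
      rw [e, e'] at hadj
    · exact absurd rfl hadj.ne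
    · exact hadj.reachable
    · exact hadj.reachable.symm
    · exact absurd rfl hadj.ne
  have : Nonempty V := ⟨p⟩
  refine SimpleGraph.Connected.mk fun r s => ?_
  rcases hV r with rfl | rfl <;> rcases hV s with rfl | rfl
  · exact SimpleGraph.Reachable.refl _
  · exact hpq
  · exact hpq.symm
  · exact SimpleGraph.Reachable.refl _

/-- A walk between different vertices would begin with an edge that is not a loop. -/
theorem Connected.subsingleton {γ : CellGraph V} (hγ : γ.Connected)
    (hl : ∀ h, γ.vertex h = γ.vertex (γ.flip h)) : Subsingleton V := by
  refine ⟨fun p q => ?_⟩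
  obtain ⟨w⟩ := hγ.preconnected p q
  cases w with
  | nil => rfl
  | cons ha _ =>
    obtain ⟨hpq, x, rfl, rfl⟩ := ha
    exact absurd (hl x) hpq

theorem eulerChar_of_isEmpty [Unique V] (γ : CellGraph V) [IsEmpty γ.HalfEdge] :
    γ.eulerChar = 2 := by
  have hc : ∀ σ : Equiv.Perm γ.HalfEdge, numCycles σ = 0 := fun σ => by
    have : IsEmpty (Quotient (Equiv.Perm.SameCycle.setoid σ)) :=
      ⟨fun q => q.inductionOn isEmptyElim⟩
    exact Nat.card_of_isEmpty
  have hI : γ.numIsolated = 1 := by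
    rw [numIsolated, Set.range_eq_empty]
    simp
  rw [eulerChar_eq, hc, hc, hI, Nat.card_unique]
  norm_num

end CellGraph

/-! ### Evaluation of an ECO functor and the induction. -/

namespace ECOFunctorAt

open CellGraph

variable {K A : Type*} [Field K] [CommRing A] [Algebra K A] [FiniteDimensional K A]
  {F : FrobeniusStructure K A} (ω : ECOFunctorAt F) {V : Type} [LinearOrder V]

theorem form_of_isEmpty [Unique V] (γ : CellGraph V) [IsEmpty γ.HalfEdge] (v : V → A) :
    ω.form γ v = F.counit (v default) := by
  have : IsEmpty (edgeless (Fin 1)).HalfEdge := inferInstanceAs (IsEmpty Empty)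
  have h := ω.form_iso γ (edgeless (Fin 1))
    { label := OrderIso.ofUnique V (Fin 1)
      halfEdge := Equiv.equivOfIsEmpty _ _
      rot_comm := isEmptyElim
      flip_comm := isEmptyElim
      vertex_comm := isEmptyElim } fun _ => v default
  rw [ω.form_point] at h
  rw [← h]
  congr 1
  funext p
  rw [Subsingleton.elim p default]

theorem prod_mergeVector [Fintype V] (v : V → A) {i j : V} (hij : i ≠ j)
    [Fintype {p : V // p ≠ j}] : ∏ p, mergeVector v i j p = ∏ p, v p := by
  classical
  have h0 : ∏ p, v p = v j * ∏ p : {p : V // p ≠ j}, v p.1 := by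
    rw [Fintype.prod_eq_mul_prod_subtype_ne v j]
    congr!
  rw [h0,
    Fintype.prod_eq_mul_prod_compl (⟨i, hij⟩ : {p : V // p ≠ j}) (mergeVector v i j),
    Fintype.prod_eq_mul_prod_compl (⟨i, hij⟩ : {p : V // p ≠ j}) (fun p => v p.1)]
  have h1 : mergeVector v i j ⟨i, hij⟩ = v i * v j := by simp [mergeVector]
  have h2 : ∏ p ∈ {(⟨i, hij⟩ : {p : V // p ≠ j})}ᶜ, mergeVector v i j p =
      ∏ p ∈ {(⟨i, hij⟩ : {p : V // p ≠ j})}ᶜ, v p.1 := by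
    refine Finset.prod_congr rfl fun p hp => ?_
    have : p.1 ≠ i := fun e => by simp [Subtype.ext_iff, e] at hp
    simp [mergeVector, this]
  rw [h1, h2]
  ring

theorem prod_splitVector [Subsingleton V] (v : V → A) (i : V) (a b : A)
    [Fintype (SplitLabel V i)] : ∏ p, splitVector v i a b p = a * b := by
  classical
  have : (Finset.univ : Finset (SplitLabel V i)) = {leftLabel i, rightLabel i} := by
    ext p
    simpa using eq_leftLabel_or_eq_rightLabel p
  rw [this, Finset.prod_pair (leftLabel_ne_rightLabel i), splitVector_leftLabel,
    splitVector_rightLabel]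

/-- The form of a connected one-vertex graph, in terms of that of the connected graph left by
the contraction of a loop. -/
theorem form_loop_of_handle [Fintype V] [Subsingleton V] (γ : CellGraph V) (hγ : γ.Connected)
    (h : γ.HalfEdge) (hloop : γ.vertex (γ.flip h) = γ.vertex h) (g : ℕ)
    (hform : ∀ a b v, ω.form (γ.contractLoop h hloop) (splitVector v (γ.vertex h) a b) =
      F.counit (a * b * F.euler ^ g)) (v : V → A) :
    ω.form γ v = F.counit ((∏ i, v i) * F.euler ^ (g + 1)) := by
  -- The contracted form depends on `a` and `b` only through `a * b`, so it factors through `m` and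
  -- `m ∘ δ` appears.
  have hl : TensorProduct.lift
      (insertPair (γ.vertex h) (ω.form (γ.contractLoop h hloop)) v) =
        F.counit ∘ₗ LinearMap.mulRight K (F.euler ^ g) ∘ₗ LinearMap.mul' K A :=
    TensorProduct.ext' fun a b => hform a b v
  rw [ω.form_contractLoop γ hγ h hloop, hl, Fintype.prod_subsingleton v (γ.vertex h)]
  simp only [LinearMap.comp_apply, LinearMap.mulRight_apply, F.mul'_comul]
  congr 1
  ring

/-- The form of a connected one-vertex graph, in terms of those of the two graphs left by the
contraction of a separating loop. -/
theorem form_separating_loop [Fintype V] [Subsingleton V] (γ : CellGraph V) (hγ : γ.Connected)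
    (h : γ.HalfEdge) (hloop : γ.vertex (γ.flip h) = γ.vertex h) (g₁ g₂ : ℕ)
    (hform : ∀ a b v, ω.form (γ.contractLoop h hloop) (splitVector v (γ.vertex h) a b) =
      F.counit (a * F.euler ^ g₁) * F.counit (b * F.euler ^ g₂)) (v : V → A) :
    ω.form γ v = F.counit ((∏ i, v i) * F.euler ^ (g₁ + g₂)) := by
  have hl : insertPair (γ.vertex h) (ω.form (γ.contractLoop h hloop)) v =
      F.counitMulPair (F.euler ^ g₁) (F.euler ^ g₂) :=
    LinearMap.ext₂ fun a b => hform a b v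
  rw [ω.form_contractLoop γ hγ h hloop, hl, Fintype.prod_subsingleton v (γ.vertex h),
    F.lift_counitMulPair_comul, pow_add]

/-- The genus is produced, not given, because the two pieces left by a separating loop come without
a known genus. The label type varies because every contraction changes it. -/
theorem exists_genus_and_form (m : ℕ) : ∀ (V : Type) [LinearOrder V] [Fintype V]
    (γ : CellGraph V), Nat.card γ.HalfEdge = m → γ.Connected →
      ∃ g : ℕ, γ.eulerChar = 2 - 2 * (g : ℤ) ∧
        ∀ v : V → A, ω.form γ v = F.counit ((∏ i, v i) * F.euler ^ g) := by
  classical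
  induction m using Nat.strong_induction_on with
  | _ m ih =>
  intro V _ _ γ hm hγ
  have := γ.finite
  by_cases hl : ∀ h, γ.vertex h = γ.vertex (γ.flip h)
  · have := hγ.subsingleton hl
    have : Unique V :=
      { default := hγ.nonempty.some, uniq := fun _ => Subsingleton.elim _ _ }
    rcases isEmpty_or_nonempty γ.HalfEdge with he | ⟨⟨h⟩⟩
    · refine ⟨0, by rw [γ.eulerChar_of_isEmpty]; norm_num, fun v => ?_⟩
      rw [ω.form_of_isEmpty, Fintype.prod_unique, pow_zero, mul_one]
    have hloop := (hl h).symm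
    set γ' := γ.contractLoop h hloop with hγ'
    have hχ : γ'.eulerChar = γ.eulerChar + 2 := γ.eulerChar_contractLoop h hloop
    have hlt : Nat.card γ'.HalfEdge < m := hm ▸ γ.card_remaining_lt h
    have : Fintype (SplitLabel V (γ.vertex h)) := Fintype.ofFinite _
    -- With only two vertices left, either no edge joins them (separating loop) or the graph is
    -- connected (loop of handle).
    by_cases hS : γ'.IsUnionOfComponents {leftLabel (γ.vertex h)}
    · have hsub : ∀ p q : ({leftLabel (γ.vertex h)}ᶜ : Set (SplitLabel V (γ.vertex h))), p = q :=
        fun p q => Subtype.ext (((eq_leftLabel_or_eq_rightLabel p.1).resolve_left p.2).trans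
          ((eq_leftLabel_or_eq_rightLabel q.1).resolve_left q.2).symm)
      have : Subsingleton ({leftLabel (γ.vertex h)}ᶜ : Set (SplitLabel V (γ.vertex h))) := ⟨hsub⟩
      have hr : rightLabel (γ.vertex h) ∈
          ({leftLabel (γ.vertex h)}ᶜ : Set (SplitLabel V (γ.vertex h))) :=
        (leftLabel_ne_rightLabel _).symm
      have : Nonempty ({leftLabel (γ.vertex h)}ᶜ : Set (SplitLabel V (γ.vertex h))) := ⟨⟨_, hr⟩⟩
      have := γ'.finite
      obtain ⟨g₁, hg₁, hf₁⟩ := ih _ ((Finite.card_subtype_le _).trans_lt hlt) _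
        (γ'.restrict _ hS) rfl (connected_of_subsingleton _)
      obtain ⟨g₂, hg₂, hf₂⟩ := ih _ ((Finite.card_subtype_le _).trans_lt hlt) _
        (γ'.restrict _ hS.compl) rfl (connected_of_subsingleton _)
      refine ⟨g₁ + g₂, ?_, ω.form_separating_loop γ hγ h hloop g₁ g₂ fun a b v => ?_⟩
      -- From `χ₁ + χ₂ = χ + 2` the genera add.
      · have := γ'.eulerChar_restrict_add _ hS
        push_cast
        linarith
      · rw [ω.form_disjoint_union _ _ hS, hf₁, hf₂,
          Fintype.prod_subsingleton _ ⟨leftLabel (γ.vertex h), rfl⟩,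
          Fintype.prod_subsingleton _ ⟨rightLabel (γ.vertex h), hr⟩,
          splitVector_leftLabel, splitVector_rightLabel]
    · have hconn : γ'.Connected := by
        by_contra hc
        refine hS fun x => ?_
        by_cases hx : γ'.vertex x = γ'.vertex (γ'.flip x)
        · rw [hx]
        · exact absurd (γ'.connected_of_adj_pair eq_leftLabel_or_eq_rightLabel x hx) hc
      obtain ⟨g, hg, hf⟩ := ih _ hlt _ γ' rfl hconn
      refine ⟨g + 1, ?_, ω.form_loop_of_handle γ hγ h hloop g fun a b v => ?_⟩
      · push_cast
        linarith
      · rw [hf, prod_splitVector]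
  · push Not at hl
    obtain ⟨h, hne⟩ := hl
    have : Fintype {p : V // p ≠ γ.vertex (γ.flip h)} := Fintype.ofFinite _
    obtain ⟨g, hg, hf⟩ := ih _ (hm ▸ γ.card_remaining_lt h) _ (γ.contractEdge h hne) rfl
      (hγ.contractEdge γ h hne)
    refine ⟨g, by rw [← hg, eulerChar_contractEdge], fun v => ?_⟩
    rw [ω.form_contractEdge γ hγ h hne, hf, prod_mergeVector v hne]

end ECOFunctorAt

theorem mainTheorem2 {K A : Type*} [Field K] [CharZero K] [CommRing A] [Algebra K A]
    [FiniteDimensional K A] (F : FrobeniusStructure K A) (ω : ECOFunctorAt F) (g n : ℕ)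
    (V : Type) [LinearOrder V] [Fintype V] (γ : CellGraph V) (hγ : γ.HasType g n) (v : V → A) :
    ω.form γ v = F.counit ((∏ i, v i) * F.euler ^ g) := by
  obtain ⟨hconn, -, hχ⟩ := hγ
  obtain ⟨g', hg', hf⟩ := ω.exists_genus_and_form _ V γ rfl hconn
  -- The Euler characteristic determines the genus.
  obtain rfl : g = g' := by
    have := hχ.symm.trans hg'
    omega
  exact hf v
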